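/- Let $l, m$ be integers with $1 \le l \le m$, let $\mathbb F = \mathbb R$ or $\mathbb F = \mathbb C$, and put $d_{\mathbb R}(m) = \frac{(m+2)(m-1)}{2}$ and $d_{\mathbb C}(m) = m^2 - 1$. Let $\mathcal U$ be the group of orthogonal (if $\mathbb F = \mathbb R$) or unitary (if $\mathbb F = \mathbb C$) $m \times m$ matrices, with normalized Haar measure $\mu$, and for any orthogonal projection $P$ onto an $l$-dimensional subspace of $\mathbb F^m$ let $$K_{2,l,m} = \int_{\mathcal U} (U P U^*) \otimes (U P U^*) \, d\mu(U)$$ be the $2$-coherence tensor, an $m^2 \times m^2$ matrix over $\mathbb F$. Then, for every choice of $P$, the squared Hilbert-Schmidt norm of the $2$-coherence tensor is $$\|K_{2,l,m}\|_{HS}^2 = \operatorname{tr}(K_{2,l,m}^2) = \frac{l^4}{m^2} + \frac{l^2 (m-l)^2}{d_{\mathbb F}(m)\, m^2},$$ where in the degenerate case $m = 1$ (so $l = 1$ and $d_{\mathbb F}(1) = 0$) the last summand $0/0$ is read as $0$. -/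

import Mathlib

open MeasureTheory
open scoped Kronecker

namespace FusionFrame

/-- The group `𝒰` of orthogonal (`𝕜 = ℝ`) or unitary (`𝕜 = ℂ`) `m × m` matrices. -/
abbrev UGroup (𝕜 : Type) [RCLike 𝕜] (m : ℕ) : Type := Matrix.unitaryGroup (Fin m) 𝕜

/-- The orthogonal / unitary group is compact, being closed and entrywise bounded by `1`. -/
instance (𝕜 : Type) [RCLike 𝕜] (m : ℕ) : CompactSpace (UGroup 𝕜 m) := by
  have hc : IsCompact (Set.pi Set.univ fun _ : Fin m =>
      Set.pi Set.univ fun _ : Fin m => Metric.closedBall (0 : 𝕜) 1) :=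
    isCompact_univ_pi fun _ => isCompact_univ_pi fun _ => isCompact_closedBall _ _
  have hcl : IsClosed (Matrix.unitaryGroup (Fin m) 𝕜 : Set (Matrix (Fin m) (Fin m) 𝕜)) := by
    have h : (Matrix.unitaryGroup (Fin m) 𝕜 : Set (Matrix (Fin m) (Fin m) 𝕜)) =
        {A | A * star A = 1} := by
      ext A
      exact Matrix.mem_unitaryGroup_iff
    rw [h]
    exact isClosed_eq (by fun_prop) continuous_const
  refine isCompact_iff_compactSpace.mp (hc.of_isClosed_subset hcl fun A hA => ?_)
  simp only [Set.mem_pi, Set.mem_univ, true_imp_iff, mem_closedBall_zero_iff]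
  exact fun i j => entry_norm_bound_of_unitary hA i j

/-- The Borel σ-algebra on the orthogonal / unitary group. -/
instance (𝕜 : Type) [RCLike 𝕜] (m : ℕ) : MeasurableSpace (UGroup 𝕜 m) := borel _

instance (𝕜 : Type) [RCLike 𝕜] (m : ℕ) : BorelSpace (UGroup 𝕜 m) := ⟨rfl⟩

/-- The Haar measure on the orthogonal / unitary group, of total mass `1`. -/
noncomputable def haarU (𝕜 : Type) [RCLike 𝕜] (m : ℕ) : Measure (UGroup 𝕜 m) :=
  Measure.haarMeasure ⊤

instance (𝕜 : Type) [RCLike 𝕜] (m : ℕ) : IsProbabilityMeasure (haarU 𝕜 m) :=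
  ⟨Measure.haarMeasure_self⟩

instance (𝕜 : Type) [RCLike 𝕜] (m : ℕ) : (haarU 𝕜 m).IsHaarMeasure :=
  Measure.isHaarMeasure_haarMeasure _

/-- `P` is the matrix of an orthogonal projection onto an `l`-dimensional subspace of `𝕜^m`:
`P* = P = P²` and `rank P = l`. -/
def IsRankProj {𝕜 : Type} [RCLike 𝕜] {m : ℕ} (l : ℕ) (P : Matrix (Fin m) (Fin m) 𝕜) : Prop :=
  IsStarProjection P ∧ P.rank = l

/-- `(U P U*)^{⊗ 2}`, as an `m² × m²` Kronecker product matrix. -/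
def conjTensorSq {𝕜 : Type} [RCLike 𝕜] {m : ℕ} (P : Matrix (Fin m) (Fin m) 𝕜)
    (U : UGroup 𝕜 m) : Matrix (Fin m × Fin m) (Fin m × Fin m) 𝕜 :=
  ((U : Matrix (Fin m) (Fin m) 𝕜) * P * (U : Matrix (Fin m) (Fin m) 𝕜).conjTranspose) ⊗ₖ
    ((U : Matrix (Fin m) (Fin m) 𝕜) * P * (U : Matrix (Fin m) (Fin m) 𝕜).conjTranspose)

/-- The entries of the matrix-valued integrand are integrable. -/
theorem integrable_conjTensorSq {𝕜 : Type} [RCLike 𝕜] {m : ℕ} (P : Matrix (Fin m) (Fin m) 𝕜)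
    (a b : Fin m × Fin m) :
    Integrable (fun U : UGroup 𝕜 m => conjTensorSq P U a b) (haarU 𝕜 m) := by
  have hA : Continuous fun U : UGroup 𝕜 m => (U : Matrix (Fin m) (Fin m) 𝕜) * P *
      (U : Matrix (Fin m) (Fin m) 𝕜).conjTranspose :=
    (continuous_subtype_val.matrix_mul continuous_const).matrix_mul
      continuous_subtype_val.matrix_conjTranspose
  have h : Continuous fun U : UGroup 𝕜 m => conjTensorSq P U a b :=
    (hA.matrix_elem a.1 b.1).mul (hA.matrix_elem a.2 b.2)
  exact h.integrable_of_hasCompactSupport (HasCompactSupport.of_compactSpace _)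

/-- The 2-coherence tensor `∫ (U P U*)^{⊗ 2} dμ(U)` (the matrix-valued integral taken
entrywise); for a rank-`l` orthogonal projection `P` of `𝕜^m` this is `K_{2,l,m}`. -/
noncomputable def coherenceTensor {𝕜 : Type} [RCLike 𝕜] {m : ℕ}
    (P : Matrix (Fin m) (Fin m) 𝕜) : Matrix (Fin m × Fin m) (Fin m × Fin m) 𝕜 :=
  Matrix.of fun a b => ∫ U, conjTensorSq P U a b ∂(haarU 𝕜 m)

/-- The squared Hilbert-Schmidt norm of a matrix. -/
noncomputable def hsNormSq {𝕜 : Type} [RCLike 𝕜] {ι : Type} [Fintype ι]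
    (A : Matrix ι ι 𝕜) : ℝ :=
  ∑ a, ∑ b, ‖A a b‖ ^ 2

/-- `d_ℝ(m) = (m + 2)(m - 1) / 2`. -/
noncomputable def dReal (m : ℕ) : ℝ := ((m : ℝ) + 2) * ((m : ℝ) - 1) / 2

/-- `d_ℂ(m) = m² - 1`. -/
def dComplex (m : ℕ) : ℝ := (m : ℝ) ^ 2 - 1

end FusionFrame

namespace FusionFrame

open Matrix

section

variable {𝕜 : Type} [RCLike 𝕜] {m : ℕ}

/-! Expanding `K²` as a double Haar integral and using invariance to absorb one variable turns `tr
K²` into `secondMoment P P`, where `secondMoment P A = ∫ tr(U P U* A)² dμ(U)`. As a function of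
Hermitian `A` this is a quadratic form invariant under conjugation. Diagonalising `A` and permuting
coordinates forces it to be `x tr(A²) + b (tr A)²` (`exists_secondMoment_eq`).

Two evaluations determine `x` and `b`: at `A = 1`, and summed over a tight frame of Hermitian
matrices (`sum_secondMoment_units`), where a Parseval identity makes the integrand constant. The
field enters only through `RCLike.I * RCLike.I`, which is `0` over `ℝ` and `-1` over `ℂ`. -/

/-- The conjugate `U P U*` of `P` by `U`. -/
def conjBy (P : Matrix (Fin m) (Fin m) 𝕜) (U : UGroup 𝕜 m) : Matrix (Fin m) (Fin m) 𝕜 :=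
  (U : Matrix (Fin m) (Fin m) 𝕜) * P * (U : Matrix (Fin m) (Fin m) 𝕜).conjTranspose

theorem continuous_conjBy (P : Matrix (Fin m) (Fin m) 𝕜) : Continuous (conjBy P) :=
  (continuous_subtype_val.matrix_mul continuous_const).matrix_mul
    continuous_subtype_val.matrix_conjTranspose

theorem integrable_haarU_of_continuous {f : UGroup 𝕜 m → 𝕜} (hf : Continuous f) :
    Integrable f (haarU 𝕜 m) :=
  hf.integrable_of_hasCompactSupport (HasCompactSupport.of_compactSpace _)

theorem conjBy_mul (P : Matrix (Fin m) (Fin m) 𝕜) (V U : UGroup 𝕜 m) :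
    conjBy P (V * U) = conjBy (conjBy P U) V := by
  simp [conjBy, Matrix.mul_assoc]

theorem conjTranspose_mul_self_coe (U : UGroup 𝕜 m) :
    (U : Matrix (Fin m) (Fin m) 𝕜)ᴴ * (U : Matrix (Fin m) (Fin m) 𝕜) = 1 :=
  Matrix.mem_unitaryGroup_iff'.mp U.2

theorem trace_conjBy (P : Matrix (Fin m) (Fin m) 𝕜) (U : UGroup 𝕜 m) :
    (conjBy P U).trace = P.trace := by
  rw [conjBy, Matrix.trace_mul_comm, ← Matrix.mul_assoc, conjTranspose_mul_self_coe, one_mul]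

theorem conjBy_mul_conjBy (A B : Matrix (Fin m) (Fin m) 𝕜) (U : UGroup 𝕜 m) :
    conjBy A U * conjBy B U = conjBy (A * B) U := by
  calc conjBy A U * conjBy B U
      = (U : Matrix (Fin m) (Fin m) 𝕜) * A * ((U : Matrix (Fin m) (Fin m) 𝕜)ᴴ * U) * B *
          (U : Matrix (Fin m) (Fin m) 𝕜)ᴴ := by simp only [conjBy, Matrix.mul_assoc]
    _ = conjBy (A * B) U := by
      rw [conjTranspose_mul_self_coe, mul_one, conjBy, Matrix.mul_assoc _ A B]

theorem isHermitian_conjBy {P : Matrix (Fin m) (Fin m) 𝕜} (hP : P.IsHermitian)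
    (U : UGroup 𝕜 m) : (conjBy P U).IsHermitian :=
  Matrix.isHermitian_mul_mul_conjTranspose _ hP

theorem integral_conjBy_mul_left (P : Matrix (Fin m) (Fin m) 𝕜)
    (f : Matrix (Fin m) (Fin m) 𝕜 → 𝕜) (V : UGroup 𝕜 m) :
    ∫ U, f (conjBy (conjBy P U) V) ∂(haarU 𝕜 m) = ∫ U, f (conjBy P U) ∂(haarU 𝕜 m) := by
  simp_rw [← conjBy_mul]
  exact integral_mul_left_eq_self (fun U => f (conjBy P U)) V

/-- The second moment `∫ tr(U P U* A)² dμ(U)`. -/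
noncomputable def secondMoment (P A : Matrix (Fin m) (Fin m) 𝕜) : 𝕜 :=
  ∫ U, (conjBy P U * A).trace ^ 2 ∂(haarU 𝕜 m)

/-- Translating `U` to `V * U` conjugates both factors in the trace by `V`, which leaves the trace
unchanged. -/
theorem secondMoment_conjBy (P A : Matrix (Fin m) (Fin m) 𝕜) (V : UGroup 𝕜 m) :
    secondMoment P (conjBy A V) = secondMoment P A := by
  rw [secondMoment, ← integral_conjBy_mul_left P (fun Q => (Q * conjBy A V).trace ^ 2) V]
  simp_rw [conjBy_mul_conjBy, trace_conjBy]
  rfl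

/-- The correlation of two diagonal entries of `U P U*`. -/
noncomputable def diagCorr (P : Matrix (Fin m) (Fin m) 𝕜) (i j : Fin m) : 𝕜 :=
  ∫ U, conjBy P U i i * conjBy P U j j ∂(haarU 𝕜 m)

theorem permMatrix_mem_unitaryGroup (σ : Equiv.Perm (Fin m)) :
    σ.permMatrix 𝕜 ∈ Matrix.unitaryGroup (Fin m) 𝕜 := by
  rw [Matrix.mem_unitaryGroup_iff, Matrix.star_eq_conjTranspose, Matrix.conjTranspose_permMatrix,
    ← Matrix.permMatrix_mul]
  simp

theorem conjBy_permMatrix_apply (A : Matrix (Fin m) (Fin m) 𝕜) (σ : Equiv.Perm (Fin m))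
    (i j : Fin m) :
    conjBy A ⟨σ.permMatrix 𝕜, permMatrix_mem_unitaryGroup σ⟩ i j = A (σ i) (σ j) := by
  simp [conjBy, Matrix.conjTranspose_permMatrix, Equiv.Perm.permMatrix,
    PEquiv.toMatrix_toPEquiv_mul, PEquiv.mul_toMatrix_toPEquiv, ← Equiv.Perm.inv_def]

theorem diagCorr_perm (P : Matrix (Fin m) (Fin m) 𝕜) (σ : Equiv.Perm (Fin m)) (i j : Fin m) :
    diagCorr P (σ i) (σ j) = diagCorr P i j := by
  have h := integral_conjBy_mul_left P (fun Q => Q i i * Q j j)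
    ⟨σ.permMatrix 𝕜, permMatrix_mem_unitaryGroup σ⟩
  simpa only [conjBy_permMatrix_apply, diagCorr] using h

/-- Permutations act transitively on indices and on ordered pairs of distinct indices, so the
correlation takes one value on the diagonal and one off it; `x` is their difference. -/
theorem exists_diagCorr_eq (P : Matrix (Fin m) (Fin m) 𝕜) :
    ∃ x b : 𝕜, ∀ i j, diagCorr P i j = (if i = j then x else 0) + b := by
  rcases isEmpty_or_nonempty (Fin m) with h | ⟨⟨i₀⟩⟩
  · exact ⟨0, 0, fun i => isEmptyElim i⟩
  have hd : ∀ i, diagCorr P i i = diagCorr P i₀ i₀ := fun i => by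
    have := diagCorr_perm P (Equiv.swap i₀ i) i₀ i₀
    simpa using this
  rcases subsingleton_or_nontrivial (Fin m) with h | h
  -- With a single index there is no off-diagonal value, so any splitting of the diagonal one works.
  · refine ⟨diagCorr P i₀ i₀, 0, fun i j => ?_⟩
    rw [Subsingleton.elim i i₀, Subsingleton.elim j i₀]
    simp
  · obtain ⟨j₀, hj₀⟩ := exists_ne i₀
    refine ⟨diagCorr P i₀ i₀ - diagCorr P i₀ j₀, diagCorr P i₀ j₀, fun i j => ?_⟩
    by_cases hij : i = j
    · subst hij
      simp [hd i]
    · have hinj : ∀ {p q : Fin m}, p ≠ q → Function.Injective ![p, q] := fun {p q} hpq s t => by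
        fin_cases s <;> fin_cases t <;> simp [hpq, hpq.symm]
      obtain ⟨σ, hσ⟩ := Equiv.Perm.exists_extending_pair _ _ (hinj hj₀.symm) (hinj hij)
      have := diagCorr_perm P σ i₀ j₀
      rw [show σ i₀ = i from hσ 0, show σ j₀ = j from hσ 1] at this
      simp [hij, this]

theorem secondMoment_diagonal (P : Matrix (Fin m) (Fin m) 𝕜) (v : Fin m → 𝕜) :
    secondMoment P (diagonal v) = ∑ i, ∑ j, diagCorr P i j * (v i * v j) := by
  have h : ∀ U, (conjBy P U * diagonal v).trace ^ 2 =
      ∑ i, ∑ j, conjBy P U i i * conjBy P U j j * (v i * v j) := fun U => by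
    simp only [Matrix.trace, Matrix.diag_apply, Matrix.mul_diagonal, sq, Finset.sum_mul_sum]
    exact Finset.sum_congr rfl fun i _ => Finset.sum_congr rfl fun j _ => by ring
  have hc : ∀ i j, Integrable (fun U => conjBy P U i i * conjBy P U j j * (v i * v j))
      (haarU 𝕜 m) := fun i j => integrable_haarU_of_continuous
    ((((continuous_conjBy P).matrix_elem i i).mul
      ((continuous_conjBy P).matrix_elem j j)).mul_const _)
  simp_rw [secondMoment, h]
  rw [integral_finsetSum _ fun i _ => integrable_finsetSum _ fun j _ => hc i j]
  refine Finset.sum_congr rfl fun i _ => ?_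
  rw [integral_finsetSum _ fun j _ => hc i j]
  exact Finset.sum_congr rfl fun j _ => integral_mul_const _ _

/-- By the spectral theorem and invariance it is enough to treat diagonal `A`, where the form is
governed by `diagCorr`. -/
theorem exists_secondMoment_eq (P : Matrix (Fin m) (Fin m) 𝕜) :
    ∃ x b : 𝕜, ∀ A : Matrix (Fin m) (Fin m) 𝕜, A.IsHermitian →
      secondMoment P A = x * (A * A).trace + b * A.trace ^ 2 := by
  obtain ⟨x, b, h⟩ := exists_diagCorr_eq P
  refine ⟨x, b, fun A hA => ?_⟩
  obtain ⟨V, v, rfl⟩ : ∃ (V : UGroup 𝕜 m) (v : Fin m → 𝕜), A = conjBy (diagonal v) V :=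
    ⟨hA.eigenvectorUnitary, _, hA.spectral_theorem⟩
  rw [secondMoment_conjBy, conjBy_mul_conjBy, trace_conjBy, trace_conjBy, secondMoment_diagonal,
    Matrix.diagonal_mul_diagonal, Matrix.trace_diagonal, Matrix.trace_diagonal]
  simp only [h, add_mul, Finset.sum_add_distrib, ite_mul, zero_mul, Finset.sum_ite_eq,
    Finset.mem_univ, if_true, sq, Finset.sum_mul_sum, ← Finset.mul_sum]

theorem secondMoment_one (P : Matrix (Fin m) (Fin m) 𝕜) : secondMoment P 1 = P.trace ^ 2 := by
  simp [secondMoment, trace_conjBy]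

/-! ### A tight frame of Hermitian matrices -/

/-- Twice the real part of the matrix unit at `(i, j)`. -/
def symmUnit (𝕜 : Type) [RCLike 𝕜] (i j : Fin m) : Matrix (Fin m) (Fin m) 𝕜 :=
  single i j 1 + single j i 1

/-- Twice the imaginary part of the matrix unit at `(i, j)`; it vanishes over `ℝ`. -/
noncomputable def skewUnit (𝕜 : Type) [RCLike 𝕜] (i j : Fin m) : Matrix (Fin m) (Fin m) 𝕜 :=
  (RCLike.I : 𝕜) • (single i j 1 - single j i 1)

theorem isHermitian_symmUnit (i j : Fin m) : (symmUnit 𝕜 i j).IsHermitian := by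
  simp [Matrix.IsHermitian, symmUnit, add_comm]

theorem isHermitian_skewUnit (i j : Fin m) : (skewUnit 𝕜 i j).IsHermitian := by
  simp [Matrix.IsHermitian, skewUnit, ← smul_neg]

theorem trace_mul_symmUnit (A : Matrix (Fin m) (Fin m) 𝕜) (i j : Fin m) :
    (A * symmUnit 𝕜 i j).trace = A j i + A i j := by
  simp [symmUnit, mul_add, Matrix.trace_mul_single]

theorem trace_mul_skewUnit (A : Matrix (Fin m) (Fin m) 𝕜) (i j : Fin m) :
    (A * skewUnit 𝕜 i j).trace = RCLike.I * (A j i - A i j) := by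
  simp [skewUnit, mul_sub, Matrix.trace_mul_single]

theorem trace_symmUnit (i j : Fin m) :
    (symmUnit 𝕜 i j).trace = if i = j then 2 else 0 := by
  rw [← one_mul (symmUnit 𝕜 i j), trace_mul_symmUnit]
  by_cases h : i = j
  · subst h; norm_num
  · simp [h, Ne.symm h]

theorem trace_skewUnit (i j : Fin m) : (skewUnit 𝕜 i j).trace = 0 := by
  rw [← one_mul (skewUnit 𝕜 i j), trace_mul_skewUnit]
  by_cases h : i = j
  · subst h; simp
  · simp [h, Ne.symm h]

theorem trace_symmUnit_mul_self (i j : Fin m) :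
    (symmUnit 𝕜 i j * symmUnit 𝕜 i j).trace = 2 + if i = j then 2 else 0 := by
  rw [trace_mul_symmUnit]
  by_cases h : i = j
  · subst h; simp [symmUnit]; norm_num
  · simp [symmUnit, h, Ne.symm h]; norm_num

theorem trace_skewUnit_mul_self (i j : Fin m) :
    (skewUnit 𝕜 i j * skewUnit 𝕜 i j).trace =
      -(RCLike.I * RCLike.I) * (2 - if i = j then 2 else 0) := by
  rw [trace_mul_skewUnit]
  by_cases h : i = j
  · subst h; simp [skewUnit]
  · simp [skewUnit, h, Ne.symm h]; ring

/-- Parseval: each pair `(i, j)` contributes `4 * A i j * A j i`, that is, four times the squared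
modulus of an entry. -/
theorem sum_sq_trace_mul_units {A : Matrix (Fin m) (Fin m) 𝕜} (hA : A.IsHermitian) :
    ∑ i, ∑ j, ((A * symmUnit 𝕜 i j).trace ^ 2 + (A * skewUnit 𝕜 i j).trace ^ 2) =
      4 * (A * A).trace := by
  simp only [trace_mul_symmUnit, trace_mul_skewUnit]
  simp only [Matrix.trace, Matrix.diag_apply, Matrix.mul_apply, Finset.mul_sum]
  refine Finset.sum_congr rfl fun i _ => Finset.sum_congr rfl fun j _ => ?_
  -- Either `I = 0`, and a Hermitian matrix is symmetric, or `I * I = -1`, and the cross terms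
  -- combine.
  rcases RCLike.I_mul_I (K := 𝕜) with h | h
  · have h1 : A j i = A i j := by
      rw [← hA.apply i j]
      exact (RCLike.conj_eq_iff_im.mpr (by
        rw [← RCLike.I_im', h]
        simp_all)).symm
    rw [h1]; ring
  · linear_combination (A j i - A i j) ^ 2 * h

theorem sum_secondMoment_units {P : Matrix (Fin m) (Fin m) 𝕜} (hP : P.IsHermitian) :
    ∑ i, ∑ j, (secondMoment P (symmUnit 𝕜 i j) + secondMoment P (skewUnit 𝕜 i j)) =
      4 * (P * P).trace := by
  have hc : ∀ A : Matrix (Fin m) (Fin m) 𝕜,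
      Integrable (fun U => (conjBy P U * A).trace ^ 2) (haarU 𝕜 m) := fun A =>
    integrable_haarU_of_continuous
      (((continuous_conjBy P).matrix_mul continuous_const).matrix_trace.pow 2)
  calc _ = ∑ i, ∑ j, ∫ U, ((conjBy P U * symmUnit 𝕜 i j).trace ^ 2 +
        (conjBy P U * skewUnit 𝕜 i j).trace ^ 2) ∂(haarU 𝕜 m) :=
      Finset.sum_congr rfl fun i _ => Finset.sum_congr rfl fun j _ =>
        (integral_add (hc _) (hc _)).symm
    _ = ∫ U, ∑ i, ∑ j, ((conjBy P U * symmUnit 𝕜 i j).trace ^ 2 +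
        (conjBy P U * skewUnit 𝕜 i j).trace ^ 2) ∂(haarU 𝕜 m) := by
      rw [integral_finsetSum]
      swap
      · exact fun i _ => integrable_finsetSum _ fun j _ => (hc _).add (hc _)
      exact Finset.sum_congr rfl fun i _ =>
        (integral_finsetSum _ fun j _ => (hc _).add (hc _)).symm
    _ = 4 * (P * P).trace := by
      simp [sum_sq_trace_mul_units (isHermitian_conjBy hP _), conjBy_mul_conjBy, trace_conjBy]

theorem trace_eq_of_isRankProj {l : ℕ} {P : Matrix (Fin m) (Fin m) 𝕜} (hP : IsRankProj l P) :
    P.trace = l := by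
  have h : IsIdempotentElem (Matrix.toLin' P) := by
    rw [IsIdempotentElem, Module.End.mul_eq_comp, ← Matrix.toLin'_mul, hP.1.isIdempotentElem.eq]
  rw [← Matrix.trace_toLin'_eq, (LinearMap.IsIdempotentElem.isProj_range _ h).trace, ← hP.2]
  rfl

/-- The second moment of a rank-`l` projection against itself is determined by two linear
equations in the coefficients of the invariant quadratic form `x tr(A²) + b (tr A)²`. -/
theorem exists_secondMoment_self_eq {l : ℕ} {P : Matrix (Fin m) (Fin m) 𝕜}
    (hP : IsRankProj l P) :
    ∃ x b : 𝕜, secondMoment P P = x * l + b * l ^ 2 ∧ x * m + b * m ^ 2 = l ^ 2 ∧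
      x * (m ^ 2 + m - RCLike.I * RCLike.I * (m ^ 2 - m)) + 2 * b * m = 2 * l := by
  have hH : P.IsHermitian := hP.1.isSelfAdjoint
  have hPP : P * P = P := hP.1.isIdempotentElem
  obtain ⟨x, b, h⟩ := exists_secondMoment_eq P
  refine ⟨x, b, ?_, ?_, ?_⟩
  · rw [h P hH, hPP, trace_eq_of_isRankProj hP]
  · have h1 := h 1 Matrix.isHermitian_one
    rw [secondMoment_one, trace_eq_of_isRankProj hP] at h1
    simpa using h1.symm
  -- Half the resulting coefficient of `x` is the real dimension of the space of Hermitian matrices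
  -- over either field.
  · have h2 := sum_secondMoment_units hH
    rw [hPP, trace_eq_of_isRankProj hP] at h2
    have h3 : ∀ i j : Fin m, secondMoment P (symmUnit 𝕜 i j) + secondMoment P (skewUnit 𝕜 i j) =
        2 * x * (1 - RCLike.I * RCLike.I) +
          if i = j then 2 * x * (1 + RCLike.I * RCLike.I) + 4 * b else 0 := fun i j => by
      rw [h _ (isHermitian_symmUnit i j), h _ (isHermitian_skewUnit i j), trace_symmUnit,
        trace_skewUnit, trace_symmUnit_mul_self, trace_skewUnit_mul_self]
      split_ifs <;> ring
    simp only [h3, Finset.sum_add_distrib, Finset.sum_ite_eq, Finset.mem_univ, if_true,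
      Finset.sum_const, Finset.card_univ, Fintype.card_fin, nsmul_eq_mul] at h2
    linear_combination h2 / 2

/-! ### From the coherence tensor to the second moment -/

theorem isHermitian_coherenceTensor {P : Matrix (Fin m) (Fin m) 𝕜} (hP : P.IsHermitian) :
    (coherenceTensor P).IsHermitian := by
  ext a b
  simp only [Matrix.conjTranspose_apply, coherenceTensor, Matrix.of_apply]
  rw [← starRingEnd_apply, ← integral_conj]
  refine integral_congr_ae (Filter.Eventually.of_forall fun U => ?_)
  have h := isHermitian_conjBy hP U
  change star (conjBy P U b.1 a.1 * conjBy P U b.2 a.2) = conjBy P U a.1 b.1 * conjBy P U a.2 b.2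
  rw [star_mul', h.apply, h.apply]

theorem hsNormSq_eq_trace_sq {ι : Type} [Fintype ι] [DecidableEq ι] {A : Matrix ι ι 𝕜}
    (hA : A.IsHermitian) : (hsNormSq A : 𝕜) = (A ^ 2).trace := by
  simp only [hsNormSq, sq A, Matrix.trace, Matrix.diag_apply, Matrix.mul_apply, map_sum]
  push_cast
  refine Finset.sum_congr rfl fun a _ => Finset.sum_congr rfl fun b _ => ?_
  rw [← hA.apply b a, ← starRingEnd_apply, RCLike.mul_conj]

theorem trace_coherenceTensor_mul (P : Matrix (Fin m) (Fin m) 𝕜)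
    (B : Matrix (Fin m × Fin m) (Fin m × Fin m) 𝕜) :
    (coherenceTensor P * B).trace = ∫ U, (conjTensorSq P U * B).trace ∂(haarU 𝕜 m) := by
  have hc := fun a b => (integrable_conjTensorSq P a b).mul_const (B b a)
  simp only [Matrix.trace, Matrix.diag_apply, Matrix.mul_apply]
  rw [integral_finsetSum _ fun a _ => integrable_finsetSum _ fun b _ => hc a b]
  refine Finset.sum_congr rfl fun a _ => ?_
  rw [integral_finsetSum _ fun b _ => hc a b]
  exact Finset.sum_congr rfl fun b _ => (integral_mul_const _ _).symm

/-- The trace of a Kronecker square is the square of a trace, and invariance removes `V`. The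
remaining integral over `V` in `tr K²` therefore has a constant integrand. -/
theorem trace_coherenceTensor_mul_conjTensorSq (P : Matrix (Fin m) (Fin m) 𝕜) (V : UGroup 𝕜 m) :
    (coherenceTensor P * conjTensorSq P V).trace = secondMoment P P := by
  rw [trace_coherenceTensor_mul, ← secondMoment_conjBy P P V, secondMoment]
  refine integral_congr_ae (Filter.Eventually.of_forall fun U => ?_)
  change ((conjBy P U ⊗ₖ conjBy P U) * (conjBy P V ⊗ₖ conjBy P V)).trace = _
  rw [← Matrix.mul_kronecker_mul, Matrix.trace_kronecker]
  exact (sq _).symm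

theorem trace_coherenceTensor_sq (P : Matrix (Fin m) (Fin m) 𝕜) :
    (coherenceTensor P ^ 2).trace = secondMoment P P := by
  rw [sq, trace_coherenceTensor_mul]
  simp_rw [Matrix.trace_mul_comm (conjTensorSq P _), trace_coherenceTensor_mul_conjTensorSq]
  simp

end

/-- The value of the invariant quadratic form on a rank-`l` projection, where `d + 1` is the real
dimension of the space of Hermitian matrices. -/
theorem quadForm_value_eq {F : Type*} [Field F] [CharZero F] {l m : ℕ} (hl : 1 ≤ l) (hlm : l ≤ m)
    {x b d : F} (hd : m ≠ 1 → d ≠ 0) (h1 : x * m + b * m ^ 2 = l ^ 2)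
    (h2 : x * (d + 1) + b * m = l) :
    x * l + b * l ^ 2 =
      (l : F) ^ 4 / (m : F) ^ 2 + (l : F) ^ 2 * ((m : F) - l) ^ 2 / (d * (m : F) ^ 2) := by
  have hm : (m : F) ≠ 0 := Nat.cast_ne_zero.mpr (by omega)
  -- For `m = 1` the second summand has numerator zero, so its value is `0` even if `d = 0`, and
  -- `h1` alone suffices.
  by_cases hm1 : m = 1
  · obtain rfl : l = 1 := by omega
    subst hm1
    simpa using h1
  · have hd0 := hd hm1
    have hb : b = (l ^ 2 - x * m) / m ^ 2 := by
      rw [eq_div_iff (pow_ne_zero 2 hm)]; linear_combination h1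
    -- Eliminating `b` leaves `x * m * d = l * (m - l)`.
    have hx : x = l * (m - l) / (m * d) := by
      rw [eq_div_iff (mul_ne_zero hm hd0)]; linear_combination (m : F) * h2 - h1
    rw [hb, hx]
    field_simp
    ring

end FusionFrame

theorem mainTheorem9 (l m : ℕ) (hl : 1 ≤ l) (hlm : l ≤ m) :
    (∀ P : Matrix (Fin m) (Fin m) ℝ, FusionFrame.IsRankProj l P →
      FusionFrame.hsNormSq (FusionFrame.coherenceTensor P) =
          (FusionFrame.coherenceTensor P ^ 2).trace ∧
        (FusionFrame.coherenceTensor P ^ 2).trace =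
          (l : ℝ) ^ 4 / (m : ℝ) ^ 2 +
            (l : ℝ) ^ 2 * ((m : ℝ) - (l : ℝ)) ^ 2 / (FusionFrame.dReal m * (m : ℝ) ^ 2)) ∧
    (∀ P : Matrix (Fin m) (Fin m) ℂ, FusionFrame.IsRankProj l P →
      (FusionFrame.hsNormSq (FusionFrame.coherenceTensor P) : ℂ) =
          (FusionFrame.coherenceTensor P ^ 2).trace ∧
        (FusionFrame.coherenceTensor P ^ 2).trace =
          (((l : ℝ) ^ 4 / (m : ℝ) ^ 2 +
            (l : ℝ) ^ 2 * ((m : ℝ) - (l : ℝ)) ^ 2 /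
              (FusionFrame.dComplex m * (m : ℝ) ^ 2) : ℝ) : ℂ)) := by
  have hm1 : m ≠ 1 → (m : ℝ) - 1 ≠ 0 := fun h => by
    rw [sub_ne_zero]
    exact_mod_cast h
  refine ⟨fun P hP => ⟨?_, ?_⟩, fun P hP => ⟨?_, ?_⟩⟩
  · exact FusionFrame.hsNormSq_eq_trace_sq
      (FusionFrame.isHermitian_coherenceTensor hP.1.isSelfAdjoint)
  · obtain ⟨x, b, h, h1, h2⟩ := FusionFrame.exists_secondMoment_self_eq hP
    rw [FusionFrame.trace_coherenceTensor_sq, h]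
    refine FusionFrame.quadForm_value_eq hl hlm (fun h => ?_) h1 ?_
    · exact div_ne_zero (mul_ne_zero (by positivity) (hm1 h)) two_ne_zero
    · simp only [RCLike.I_to_real] at h2
      rw [FusionFrame.dReal]
      linear_combination h2 / 2
  · exact FusionFrame.hsNormSq_eq_trace_sq
      (FusionFrame.isHermitian_coherenceTensor hP.1.isSelfAdjoint)
  · obtain ⟨x, b, h, h1, h2⟩ := FusionFrame.exists_secondMoment_self_eq hP
    rw [FusionFrame.trace_coherenceTensor_sq, h]
    push_cast
    refine FusionFrame.quadForm_value_eq hl hlm (fun h => ?_) h1 ?_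
    · rw [FusionFrame.dComplex, Complex.ofReal_ne_zero,
        show (m : ℝ) ^ 2 - 1 = ((m : ℝ) + 1) * ((m : ℝ) - 1) by ring]
      exact mul_ne_zero (by positivity) (hm1 h)
    · simp only [RCLike.I_to_complex, Complex.I_mul_I] at h2
      rw [FusionFrame.dComplex]
      push_cast
      linear_combination h2 / 2
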